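/- Let $H_1,H_2$ be non-zero complex Hilbert spaces, and let $A_1\colon \operatorname{dom}(A_1)\subseteq H_1\times H_2\to H_1$ and $A_{21}\colon \operatorname{dom}(A_{21})\subseteq H_1\to H_2$ be linear operators defined on linear subspaces. Let $S\colon H_2\to H_2$ be a bounded linear operator that is coercive, i.e. there is $\nu>0$ with $\operatorname{Re}\langle h,Sh\rangle\ge\nu\|h\|^2$ for all $h\in H_2$. Define the operator $A_{\mathrm{ext}}$ on $H_1\times H_2$ by $$\operatorname{dom}(A_{\mathrm{ext}})=\{(h_1,h_2)\in\operatorname{dom}(A_1) : h_1\in\operatorname{dom}(A_{21})\},\qquad A_{\mathrm{ext}}(h_1,h_2)=\bigl(A_1(h_1,h_2),\,A_{21}h_1\bigr),$$ and the operator $A_S$ on $H_1$ by $$\operatorname{dom}(A_S)=\{h_1\in\operatorname{dom}(A_{21}) : (h_1,SA_{21}h_1)\in\operatorname{dom}(A_1)\},\qquad A_Sh_1=A_1(h_1,SA_{21}h_1).$$ If $A_{\mathrm{ext}}$ generates a contractive $C_0$-semigroup on $H_1\times H_2$, then $$\sigma(A_S)\cap i\mathbb{R}\subseteq\sigma(A_{\mathrm{ext}})\cap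 i\mathbb{R}.$$ Here the spectrum $\sigma(A)$ of a linear operator $A$ on a Hilbert space $H$ is the set of all $\mu\in\mathbb{C}$ for which $\mu-A\colon\operatorname{dom}(A)\to H$ is not a bijection with bounded inverse. -/

import Mathlib

open Filter Topology
open scoped NNReal

namespace ClosureRelation

section Semigroups

variable {E : Type*} [NormedAddCommGroup E] [NormedSpace ℂ E]

/-- A contractive `C₀`-semigroup of bounded linear operators on `E`. -/
structure ContractionSemigroup (E : Type*) [NormedAddCommGroup E] [NormedSpace ℂ E] where
  /-- The operator at time `t ≥ 0`. -/
  op : ℝ≥0 → E →L[ℂ] E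
  op_zero : op 0 = ContinuousLinearMap.id ℂ E
  op_add : ∀ s t : ℝ≥0, op (s + t) = (op s).comp (op t)
  continuous_orbit : ∀ x : E, Continuous fun t : ℝ≥0 => op t x
  norm_op_le_one : ∀ t : ℝ≥0, ‖op t‖ ≤ 1

/-- `A` is the infinitesimal generator of the semigroup `T`: a vector `x` belongs to the domain of
`A`, with `A x = y`, if and only if `(T(t) x - x) / t → y` as `t ↓ 0`. -/
def ContractionSemigroup.IsGeneratedBy (T : ContractionSemigroup E) (A : E →ₗ.[ℂ] E) : Prop :=
  ∀ x y : E, (x, y) ∈ A.graph ↔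
    Tendsto (fun t : ℝ≥0 => ((t : ℝ) : ℂ)⁻¹ • (T.op t x - x)) (𝓝[>] 0) (𝓝 y)

/-- The unbounded operator `A` generates a contractive `C₀`-semigroup on `E`. -/
def GeneratesContractionSemigroup (A : E →ₗ.[ℂ] E) : Prop :=
  ∃ T : ContractionSemigroup E, T.IsGeneratedBy A

/-- The resolvent set of an unbounded operator `A`: those `μ` for which `μ - A` is a bijection from
the domain of `A` onto `E` whose inverse `R` is bounded. -/
def resolventSet (A : E →ₗ.[ℂ] E) : Set ℂ :=
  {μ | ∃ R : E →L[ℂ] E,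
    (∀ x : A.domain, R (μ • (x : E) - A x) = x) ∧
    ∀ y : E, ∃ x : A.domain, (x : E) = R y ∧ μ • (x : E) - A x = y}

/-- The spectrum of an unbounded operator. -/
def spec (A : E →ₗ.[ℂ] E) : Set ℂ := (resolventSet A)ᶜ

end Semigroups

section Operators

variable {H₁ H₂ : Type*} [NormedAddCommGroup H₁] [InnerProductSpace ℂ H₁]
  [NormedAddCommGroup H₂] [InnerProductSpace ℂ H₂]

/-- The bounded operator `S` is coercive: `Re ⟨h, S h⟩ ≥ ν ‖h‖²` for some `ν > 0`. -/
def IsCoerciveOp (S : H₂ →L[ℂ] H₂) : Prop :=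
  ∃ ν : ℝ, 0 < ν ∧ ∀ h : H₂, ν * ‖h‖ ^ 2 ≤ (inner ℂ h (S h)).re

/-- The extended operator on the Hilbert space product `H₁ × H₂`. Its domain is
`{(h₁, h₂) ∈ dom A₁ | h₁ ∈ dom A₂₁}` and it maps `(h₁, h₂)` to `(A₁ (h₁, h₂), A₂₁ h₁)`. -/
def extOp (A₁ : WithLp 2 (H₁ × H₂) →ₗ.[ℂ] H₁) (A₂₁ : H₁ →ₗ.[ℂ] H₂) :
    WithLp 2 (H₁ × H₂) →ₗ.[ℂ] WithLp 2 (H₁ × H₂) where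
  domain :=
    { carrier := {z | z ∈ A₁.domain ∧ z.fst ∈ A₂₁.domain}
      add_mem' := fun ha hb => ⟨A₁.domain.add_mem ha.1 hb.1, A₂₁.domain.add_mem ha.2 hb.2⟩
      zero_mem' := ⟨A₁.domain.zero_mem, A₂₁.domain.zero_mem⟩
      smul_mem' := fun c _ ha => ⟨A₁.domain.smul_mem c ha.1, A₂₁.domain.smul_mem c ha.2⟩ }
  toFun :=
    { toFun := fun z => WithLp.toLp 2 (A₁ ⟨z.1, z.2.1⟩, A₂₁ ⟨z.1.fst, z.2.2⟩)
      map_add' := fun a b => by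
        rw [← WithLp.toLp_add, Prod.mk_add_mk, ← A₁.map_add, ← A₂₁.map_add]
        rfl
      map_smul' := fun c a => by
        rw [RingHom.id_apply, ← WithLp.toLp_smul, Prod.smul_mk, ← A₁.map_smul, ← A₂₁.map_smul]
        rfl }

/-- The vector `(h₁, S A₂₁ h₁)`, as a linear function of `h₁ ∈ dom A₂₁`. -/
def closureLift (A₂₁ : H₁ →ₗ.[ℂ] H₂) (S : H₂ →L[ℂ] H₂) :
    A₂₁.domain →ₗ[ℂ] WithLp 2 (H₁ × H₂) where
  toFun h := WithLp.toLp 2 ((h : H₁), S (A₂₁ h))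
  map_add' a b := by
    rw [A₂₁.map_add, map_add, ← WithLp.toLp_add]
    rfl
  map_smul' c a := by
    rw [A₂₁.map_smul, map_smul, RingHom.id_apply, ← WithLp.toLp_smul]
    rfl

/-- The operator `A_S` on `H₁` obtained from the closure relation `h₂ = S A₂₁ h₁`. Its domain is
`{h₁ ∈ dom A₂₁ | (h₁, S A₂₁ h₁) ∈ dom A₁}` and it maps `h₁` to `A₁ (h₁, S A₂₁ h₁)`. -/
def closureOp (A₁ : WithLp 2 (H₁ × H₂) →ₗ.[ℂ] H₁) (A₂₁ : H₁ →ₗ.[ℂ] H₂) (S : H₂ →L[ℂ] H₂) :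
    H₁ →ₗ.[ℂ] H₁ where
  domain :=
    { carrier := {h | ∃ hh : h ∈ A₂₁.domain, closureLift A₂₁ S ⟨h, hh⟩ ∈ A₁.domain}
      add_mem' := by
        rintro a b ⟨ha, ha'⟩ ⟨hb, hb'⟩
        refine ⟨A₂₁.domain.add_mem ha hb, ?_⟩
        have := A₁.domain.add_mem ha' hb'
        rwa [← map_add] at this
      zero_mem' := by
        refine ⟨A₂₁.domain.zero_mem, ?_⟩
        have := A₁.domain.zero_mem
        rwa [← map_zero (closureLift A₂₁ S)] at this
      smul_mem' := by
        rintro c a ⟨ha, ha'⟩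
        refine ⟨A₂₁.domain.smul_mem c ha, ?_⟩
        have := A₁.domain.smul_mem c ha'
        rwa [← map_smul] at this }
  toFun :=
    { toFun := fun h => A₁ ⟨closureLift A₂₁ S ⟨h.1, h.2.1⟩, h.2.2⟩
      map_add' := fun a b => by
        rw [← A₁.map_add]
        congr 1
        exact Subtype.ext (map_add (closureLift A₂₁ S) ⟨a.1, a.2.1⟩ ⟨b.1, b.2.1⟩)
      map_smul' := fun c a => by
        rw [RingHom.id_apply, ← A₁.map_smul]
        congr 1
        exact Subtype.ext (map_smul (closureLift A₂₁ S) c ⟨a.1, a.2.1⟩) }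

end Operators

end ClosureRelation

/-!
Let `μ ∈ iℝ` lie in the resolvent set of the extended operator `A`, with resolvent `R`. The equation
`μ h₁ - A_S h₁ = f` says that `h = (h₁, S A₂₁ h₁)` satisfies `μ h - A h = (f, g)`, where
`g = -W h₂` and `W = S⁻¹ - μ`. Since `μ` is imaginary, `W` is coercive like `S⁻¹`, so it has a
coercive inverse `V`, and the condition on `g` becomes `(V + K) g = -(R (f, 0))₂`, where
`K g = (R (0, g))₂` is the lower right corner of `R`.

A generator of a contraction semigroup is dissipative, so `K` is accretive
(`re_inner_resolvent_nonneg`). Hence `V + K` is coercive, and therefore invertible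
(`IsCoerciveOp.exists_inverse`). The equation thus has exactly one solution
`h₁ = (R (f, -(V + K)⁻¹ (R (f, 0))₂))₁`, and it depends continuously on `f`.
-/

namespace ClosureRelation

/-- A generator of a contraction semigroup is dissipative. -/
theorem re_inner_apply_nonpos {E : Type*} [NormedAddCommGroup E] [InnerProductSpace ℂ E]
    {A : E →ₗ.[ℂ] E} (hA : GeneratesContractionSemigroup A) (x : A.domain) :
    (inner ℂ (x : E) (A x)).re ≤ 0 := by
  obtain ⟨T, hT⟩ := hA
  have hlim := (hT x (A x)).1 (A.mem_graph x)
  have hlim' : Tendsto (fun t : ℝ≥0 =>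
      (inner ℂ (x : E) (((t : ℝ) : ℂ)⁻¹ • (T.op t x - x))).re) (𝓝[>] 0)
      (𝓝 (inner ℂ (x : E) (A x)).re) :=
    (Complex.continuous_re.tendsto _).comp (tendsto_const_nhds.inner hlim)
  refine le_of_tendsto hlim' (Eventually.of_forall fun t => ?_)
  rw [inner_smul_right, ← Complex.ofReal_inv, Complex.re_ofReal_mul]
  refine mul_nonpos_of_nonneg_of_nonpos (by positivity) ?_
  rw [inner_sub_right, Complex.sub_re, sub_nonpos]
  have hself : (inner ℂ (x : E) (x : E)).re = ‖(x : E)‖ * ‖(x : E)‖ :=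
    inner_self_eq_norm_mul_norm (𝕜 := ℂ) (x : E)
  calc (inner ℂ (x : E) (T.op t x)).re ≤ ‖(x : E)‖ * ‖T.op t x‖ :=
        re_inner_le_norm (𝕜 := ℂ) _ _
    _ ≤ ‖(x : E)‖ * ‖(x : E)‖ := by
        gcongr
        simpa using (T.op t).le_of_opNorm_le (T.norm_op_le_one t) (x : E)
    _ = (inner ℂ (x : E) (x : E)).re := hself.symm

/-- The inner product of a vector with an imaginary multiple of itself is imaginary. -/
theorem re_inner_smul_self_eq_zero {E : Type*} [NormedAddCommGroup E] [InnerProductSpace ℂ E]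
    {μ : ℂ} (hμ : μ.re = 0) (x : E) : (inner ℂ x (μ • x)).re = 0 := by
  rw [inner_smul_right, inner_self_eq_norm_sq_to_K, Complex.mul_re, hμ]
  simp [← Complex.ofReal_pow]

/-- On the imaginary axis, the resolvent of a dissipative operator is accretive. -/
theorem re_inner_resolvent_nonneg {E : Type*} [NormedAddCommGroup E] [InnerProductSpace ℂ E]
    {A : E →ₗ.[ℂ] E} (hA : GeneratesContractionSemigroup A) {μ : ℂ} (hμ : μ.re = 0)
    {R : E →L[ℂ] E} (hR : ∀ y : E, ∃ x : A.domain, (x : E) = R y ∧ μ • (x : E) - A x = y) (y : E) :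
    0 ≤ (inner ℂ y (R y)).re := by
  obtain ⟨x, hx, rfl⟩ := hR y
  rw [← hx, ← inner_conj_symm, Complex.conj_re, inner_sub_right, Complex.sub_re,
    re_inner_smul_self_eq_zero hμ]
  linarith [re_inner_apply_nonpos hA x]

section Coercive

variable {H : Type*} [NormedAddCommGroup H] [InnerProductSpace ℂ H]

/-- The sum of a coercive operator and an accretive one is coercive. -/
theorem IsCoerciveOp.add_accretive {S K : H →L[ℂ] H} (hS : IsCoerciveOp S)
    (hK : ∀ h, 0 ≤ (inner ℂ h (K h)).re) : IsCoerciveOp (S + K) := by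
  obtain ⟨ν, hν, h⟩ := hS
  refine ⟨ν, hν, fun x => ?_⟩
  rw [add_apply, inner_add_right, Complex.add_re]
  linarith [h x, hK x]

/-- A coercive operator is invertible and its inverse is coercive. -/
theorem IsCoerciveOp.exists_inverse [CompleteSpace H] {S : H →L[ℂ] H} (hS : IsCoerciveOp S) :
    ∃ V : H →L[ℂ] H, (∀ x, V (S x) = x) ∧ (∀ x, S (V x) = x) ∧ IsCoerciveOp V := by
  obtain ⟨ν, hν, h⟩ := hS
  have hunit : IsUnit S := by
    refine S.isUnit_of_forall_le_norm_inner_map (c := ⟨ν, hν.le⟩) hν fun x => ?_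
    rw [norm_inner_symm, mul_comm]
    exact (h x).trans (Complex.re_le_norm _)
  obtain ⟨V, hSV, hVS⟩ := isUnit_iff_exists.1 hunit
  replace hSV : ∀ x, S (V x) = x := fun x => DFunLike.congr_fun hSV x
  -- The summand `1` only keeps the denominator positive when `S = 0`, that is, when `H` is trivial.
  refine ⟨V, fun x => DFunLike.congr_fun hVS x, hSV, ν / (‖S‖ ^ 2 + 1), by positivity,
    fun x => ?_⟩
  have hx : (inner ℂ (V x) x).re = (inner ℂ x (V x)).re := by
    rw [← inner_conj_symm, Complex.conj_re]
  have h1 := h (V x)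
  rw [hSV, hx] at h1
  refine le_trans ?_ h1
  rw [div_mul_eq_mul_div, div_le_iff₀ (by positivity), mul_assoc]
  gcongr
  have h2 : ‖x‖ ≤ ‖S‖ * ‖V x‖ := by simpa [hSV] using S.le_opNorm (V x)
  calc ‖x‖ ^ 2 ≤ (‖S‖ * ‖V x‖) ^ 2 := by gcongr
    _ ≤ ‖V x‖ ^ 2 * (‖S‖ ^ 2 + 1) := by nlinarith [sq_nonneg ‖V x‖]

end Coercive

variable {H₁ H₂ : Type*} [NormedAddCommGroup H₁] [InnerProductSpace ℂ H₁]
  [NormedAddCommGroup H₂] [InnerProductSpace ℂ H₂] [CompleteSpace H₂]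

/-- The inverse of `μ - A_S` is obtained from the resolvent of the extended operator by choosing the
second component of the right-hand side so that the closure relation `h₂ = S A₂₁ h₁` holds. -/
theorem mem_resolventSet_closureOp
    {A₁ : WithLp 2 (H₁ × H₂) →ₗ.[ℂ] H₁} {A₂₁ : H₁ →ₗ.[ℂ] H₂}
    {S : H₂ →L[ℂ] H₂} (hS : IsCoerciveOp S)
    (hgen : GeneratesContractionSemigroup (extOp A₁ A₂₁)) {μ : ℂ} (hμ : μ.re = 0)
    (hmem : μ ∈ resolventSet (extOp A₁ A₂₁)) : μ ∈ resolventSet (closureOp A₁ A₂₁ S) := by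
  obtain ⟨R, hRl, hRr⟩ := hmem
  obtain ⟨Si, hSiS, hSSi, hSi⟩ := hS.exists_inverse
  let e := (WithLp.prodContinuousLinearEquiv 2 ℂ H₁ H₂).symm
  let i₁ : H₁ →L[ℂ] WithLp 2 (H₁ × H₂) := e.toContinuousLinearMap ∘L .inl ℂ H₁ H₂
  let i₂ : H₂ →L[ℂ] WithLp 2 (H₁ × H₂) := e.toContinuousLinearMap ∘L .inr ℂ H₁ H₂
  let p₁ : WithLp 2 (H₁ × H₂) →L[ℂ] H₁ :=
    .fst ℂ H₁ H₂ ∘L e.symm.toContinuousLinearMap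
  let p₂ : WithLp 2 (H₁ × H₂) →L[ℂ] H₂ :=
    .snd ℂ H₁ H₂ ∘L e.symm.toContinuousLinearMap
  have hadd : ∀ f g, WithLp.toLp 2 (f, g) = i₁ f + i₂ g := fun f g => by
    simp [i₁, i₂, e, ← WithLp.toLp_add]
  let K : H₂ →L[ℂ] H₂ := p₂ ∘L R ∘L i₂
  have hK : ∀ g, 0 ≤ (inner ℂ g (K g)).re := fun g => by
    have := re_inner_resolvent_nonneg hgen hμ hRr (i₂ g)
    rw [WithLp.prod_inner_apply] at this
    simpa [K, i₂, p₂, e] using this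
  have hW : IsCoerciveOp (Si + (-μ) • ContinuousLinearMap.id ℂ H₂) :=
    hSi.add_accretive fun h => (re_inner_smul_self_eq_zero (by simp [hμ]) h).ge
  obtain ⟨V, hVW, hWV, hV⟩ := hW.exists_inverse
  obtain ⟨N, hNl, hNr, -⟩ := (hV.add_accretive hK).exists_inverse
  simp only [add_apply, smul_apply,
    ContinuousLinearMap.id_apply] at hVW hWV hNl hNr
  -- `G f` is the right-hand side in `H₂` for which the solution obeys the closure relation.
  let G : H₁ →L[ℂ] H₂ := -(N ∘L p₂ ∘L R ∘L i₁)
  have hp₂ : ∀ f g, (R (WithLp.toLp 2 (f, g))).snd = p₂ (R (i₁ f)) + K g := fun f g => by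
    rw [hadd, map_add]
    rfl
  refine ⟨p₁ ∘L R ∘L (i₁ + i₂ ∘L G), fun x => ?_, fun f => ?_⟩
  · obtain ⟨x, hx, hx'⟩ := x
    set u := A₂₁ ⟨x, hx⟩
    set f := μ • x - closureOp A₁ A₂₁ S ⟨x, hx, hx'⟩
    have hres := hRl ⟨closureLift A₂₁ S ⟨x, hx⟩, hx', hx⟩
    have hval : μ • closureLift A₂₁ S ⟨x, hx⟩ -
        extOp A₁ A₂₁ ⟨closureLift A₂₁ S ⟨x, hx⟩, hx', hx⟩
          = WithLp.toLp 2 (f, μ • S u - u) := rfl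
    simp only [hval] at hres
    -- The second component of the right-hand side is forced to be `G f`.
    have hG : μ • S u - u = G f := by
      have h2 : p₂ (R (i₁ f)) + K (μ • S u - u) = S u := by
        rw [← hp₂, hres]
        rfl
      have h3 : V (μ • S u - u) = -S u := by
        have := hVW (-S u)
        rw [map_neg, hSiS] at this
        rw [← this]
        congr 1
        module
      have h4 : V (μ • S u - u) + K (μ • S u - u) = -p₂ (R (i₁ f)) := by
        linear_combination (norm := module) h3 + h2
      rw [← hNl (μ • S u - u), h4, map_neg]
      rfl
    change p₁ (R (i₁ f + i₂ (G f))) = x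
    rw [← hadd, ← hG, hres]
    rfl
  · obtain ⟨⟨z, hz₁, hz₂⟩, hz, hzeq⟩ := hRr (WithLp.toLp 2 (f, G f))
    simp only at hz hzeq
    have e₁ : μ • z.fst - A₁ ⟨z, hz₁⟩ = f := congrArg WithLp.fst hzeq
    have e₂ : μ • z.snd - A₂₁ ⟨z.fst, hz₂⟩ = G f := congrArg WithLp.snd hzeq
    have hsnd : z.snd = -V (G f) := by
      have h5 : V (G f) + K (G f) = -p₂ (R (i₁ f)) := by
        have := hNr (-p₂ (R (i₁ f)))
        rw [map_neg] at this
        exact this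
      rw [hz, hp₂, eq_neg_iff_add_eq_zero, add_assoc, add_comm (K _), h5, add_neg_cancel]
    have hlift : closureLift A₂₁ S ⟨z.fst, hz₂⟩ = z := by
      have h6 : A₂₁ ⟨z.fst, hz₂⟩ = Si z.snd := by
        have := hWV (G f)
        rw [← neg_neg (V (G f)), ← hsnd, ← e₂, map_neg] at this
        linear_combination (norm := module) this
      change WithLp.toLp 2 (z.fst, S (A₂₁ ⟨z.fst, hz₂⟩)) = z
      rw [h6, hSSi]
      rfl
    have hdom : closureLift A₂₁ S ⟨z.fst, hz₂⟩ ∈ A₁.domain := by rwa [hlift]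
    refine ⟨⟨z.fst, hz₂, hdom⟩, ?_, ?_⟩
    · change z.fst = p₁ (R (i₁ f + i₂ (G f)))
      rw [← hadd, ← hz]
      rfl
    · change μ • z.fst - A₁ ⟨closureLift A₂₁ S ⟨z.fst, hz₂⟩, hdom⟩ = f
      simp only [hlift]
      exact e₁

end ClosureRelation

theorem mainTheorem1
    {H₁ : Type*} [NormedAddCommGroup H₁] [InnerProductSpace ℂ H₁] [CompleteSpace H₁] [Nontrivial H₁]
    {H₂ : Type*} [NormedAddCommGroup H₂] [InnerProductSpace ℂ H₂] [CompleteSpace H₂] [Nontrivial H₂]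
    (A₁ : WithLp 2 (H₁ × H₂) →ₗ.[ℂ] H₁) (A₂₁ : H₁ →ₗ.[ℂ] H₂)
    (S : H₂ →L[ℂ] H₂) (hS : ClosureRelation.IsCoerciveOp S)
    (hgen : ClosureRelation.GeneratesContractionSemigroup (ClosureRelation.extOp A₁ A₂₁)) :
    ClosureRelation.spec (ClosureRelation.closureOp A₁ A₂₁ S) ∩ {z : ℂ | z.re = 0} ⊆
      ClosureRelation.spec (ClosureRelation.extOp A₁ A₂₁) ∩ {z : ℂ | z.re = 0} := by
  rintro μ ⟨hspec, hμ⟩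
  exact ⟨fun hmem => hspec (ClosureRelation.mem_resolventSet_closureOp hS hgen hμ hmem), hμ⟩
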